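/- Let $\mathbb O'=\mathbb H\oplus\mathbb H$ be the para-octonions (split octonions), with multiplication $(q_1,q_2)(p_1,p_2)=(q_1p_1+\overline{p_2}q_2,\;p_2q_1+q_2\overline{p_1})$, conjugation $\overline{(q_1,q_2)}=(\overline{q_1},-q_2)$, real part $\mathrm{Re}(q_1,q_2)=\mathrm{Re}\,q_1$, inner product $\langle a,b\rangle=\mathrm{Re}[a\bar b]$ (of signature $(4,4)$) and $|a|^2=\langle a,a\rangle$. Put $$U_1=\{(1,y,z)\},\quad U_2=\{(x,1,z)\},\quad U_3=\{(x,y,1)\},$$ where in each case the triple in $\mathbb O'^3$ is required to satisfy $|x|^2+|y|^2+|z|^2>0$ (with the entry $1$ in its place), and let $\mathcal U=U_1\cup U_2\cup U_3$. For $p,q\in\mathcal U$ write $p\sim q$ if there is $\lambda\in\mathbb O'$ with $|\lambda|^2>0$ and $p_i=q_i\lambda$ for $i=1,2,3$; this is an equivalence relation. The para-octonionic projective plane is $\mathbb O'P^2=\mathcal U/{\sim}$; it is a $16$-dimensional smooth manifold with the three charts $U_i/{\sim}\to\mathbb O'^2$, $[1,u,v]\mapsto(u,v)$, $[u,1,v]\mapsto(u,v)$,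 $[u,v,1]\mapsto(u,v)$. It carries the semi-Riemannian metric which in each of these charts is $$ds^2=\frac{|du|^2(1+|v|^2)+|dv|^2(1+|u|^2)-2\,\mathrm{Re}[(u\bar v)(dv\,d\bar u)]}{(1+|u|^2+|v|^2)^2}.$$ Let $R(X,Y,Z,W)=g(R(X,Y)Z,W)$ be its Riemann curvature tensor, with the sign convention $R(X,Y)Z=\nabla_Y\nabla_XZ-\nabla_X\nabla_YZ+\nabla_{[X,Y]}Z$, and identify the tangent space at $P_0=[1,0,0]$ with $\mathbb O'^2$ by letting $(a,b)$ correspond to the tangent vector with coordinates $(a,b)$ in the chart $[1,u,v]\mapsto(u,v)$. Then for all $a,b,c,d,e,f,g,h\in\mathbb O'$, at the point $P_0$, $$\begin{aligned} R\big((a,b),(c,d),(e,f),(g,h)\big)=\;&4\langle a,e\rangle\langle c,g\rangle-4\langle c,e\rangle\langle a,g\rangle+4\langle b,f\rangle\langle d,h\rangle-4\langle d,f\rangle\langle b,h\rangle\\ &-\langle e\bar d,g\bar b\rangle+\langle e\bar b,g\bar d\rangle-\langle c\bar f,a\bar h\rangle+\langle a\bar f,c\bar h\rangle\\ &-\langle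 a\bar d-c\bar b,\;g\bar f-e\bar h\rangle. \end{aligned}$$ -/

import Mathlib

open scoped Quaternion Manifold ContDiff Topology

noncomputable section

/-- The para-octonions as a real vector space: `ℍ ⊕ ℍ`. -/
def ParaOctonion : Type := ℍ[ℝ] × ℍ[ℝ]

namespace ParaOctonion

instance : NormedAddCommGroup ParaOctonion := inferInstanceAs (NormedAddCommGroup (ℍ[ℝ] × ℍ[ℝ]))

instance : NormedSpace ℝ ParaOctonion := inferInstanceAs (NormedSpace ℝ (ℍ[ℝ] × ℍ[ℝ]))

instance : FiniteDimensional ℝ ParaOctonion :=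
  inferInstanceAs (FiniteDimensional ℝ (ℍ[ℝ] × ℍ[ℝ]))

/-- The Cayley–Dickson type product
`(q₁, q₂) (p₁, p₂) = (q₁ p₁ + p̄₂ q₂, p₂ q₁ + q₂ p̄₁)`. -/
instance : Mul ParaOctonion :=
  ⟨fun q p => (q.1 * p.1 + star p.2 * q.2, p.2 * q.1 + q.2 * star p.1)⟩

/-- The unit `(1, 0)`. -/
instance : One ParaOctonion := ⟨((1 : ℍ[ℝ]), (0 : ℍ[ℝ]))⟩

/-- Conjugation `(q₁, q₂) ↦ (q̄₁, -q₂)`. -/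
def conj (a : ParaOctonion) : ParaOctonion := (star a.1, -a.2)

/-- The real part. -/
def re (a : ParaOctonion) : ℝ := a.1.re

/-- The inner product `⟨a, b⟩ = Re (a b̄)`, of signature `(4, 4)`. -/
def ip (a b : ParaOctonion) : ℝ := re (a * conj b)

/-- The quadratic form `|a|² = ⟨a, a⟩`, which may be negative. -/
def nsq (a : ParaOctonion) : ℝ := ip a a

/-- The inverse `ā / |a|²`; used only where `|a|² > 0`. -/
def inv (a : ParaOctonion) : ParaOctonion := (nsq a)⁻¹ • conj a

theorem ext' {a b : ParaOctonion} (h₀ : a.1.re = b.1.re) (h₁ : a.1.imI = b.1.imI)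
    (h₂ : a.1.imJ = b.1.imJ) (h₃ : a.1.imK = b.1.imK) (h₄ : a.2.re = b.2.re)
    (h₅ : a.2.imI = b.2.imI) (h₆ : a.2.imJ = b.2.imJ) (h₇ : a.2.imK = b.2.imK) : a = b :=
  Prod.ext (Quaternion.ext _ _ h₀ h₁ h₂ h₃) (Quaternion.ext _ _ h₄ h₅ h₆ h₇)

theorem fst_mul (a b : ParaOctonion) : (a * b).1 = a.1 * b.1 + star b.2 * a.2 := rfl
theorem snd_mul (a b : ParaOctonion) : (a * b).2 = b.2 * a.1 + a.2 * star b.1 := rfl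
theorem fst_one : (1 : ParaOctonion).1 = 1 := rfl
theorem snd_one : (1 : ParaOctonion).2 = 0 := rfl
theorem fst_zero : (0 : ParaOctonion).1 = 0 := rfl
theorem snd_zero : (0 : ParaOctonion).2 = 0 := rfl
theorem fst_add (a b : ParaOctonion) : (a + b).1 = a.1 + b.1 := rfl
theorem snd_add (a b : ParaOctonion) : (a + b).2 = a.2 + b.2 := rfl
theorem fst_sub (a b : ParaOctonion) : (a - b).1 = a.1 - b.1 := rfl
theorem snd_sub (a b : ParaOctonion) : (a - b).2 = a.2 - b.2 := rfl
theorem fst_smul (r : ℝ) (a : ParaOctonion) : (r • a).1 = r • a.1 := rfl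
theorem snd_smul (r : ℝ) (a : ParaOctonion) : (r • a).2 = r • a.2 := rfl
theorem fst_conj (a : ParaOctonion) : (conj a).1 = star a.1 := rfl
theorem snd_conj (a : ParaOctonion) : (conj a).2 = -a.2 := rfl

theorem ip_eq (a b : ParaOctonion) : ip a b =
    a.1.re * b.1.re + a.1.imI * b.1.imI + a.1.imJ * b.1.imJ + a.1.imK * b.1.imK
      - a.2.re * b.2.re - a.2.imI * b.2.imI - a.2.imJ * b.2.imJ - a.2.imK * b.2.imK := by
  simp [ip, re, fst_mul, fst_conj, snd_conj]
  ring

theorem nsq_eq (a : ParaOctonion) : nsq a =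
    a.1.re ^ 2 + a.1.imI ^ 2 + a.1.imJ ^ 2 + a.1.imK ^ 2
      - a.2.re ^ 2 - a.2.imI ^ 2 - a.2.imJ ^ 2 - a.2.imK ^ 2 := by
  rw [nsq, ip_eq]; ring

theorem one_mul' (a : ParaOctonion) : 1 * a = a := by
  apply ext' <;> simp [fst_mul, snd_mul, fst_one, snd_one]

theorem mul_one' (a : ParaOctonion) : a * 1 = a := by
  apply ext' <;> simp [fst_mul, snd_mul, fst_one, snd_one]

theorem mul_add' (a b c : ParaOctonion) : a * (b + c) = a * b + a * c := by
  apply ext' <;> simp [fst_mul, snd_mul, fst_add, snd_add] <;> ring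

theorem add_mul' (a b c : ParaOctonion) : (a + b) * c = a * c + b * c := by
  apply ext' <;> simp [fst_mul, snd_mul, fst_add, snd_add] <;> ring

theorem smul_mul' (r : ℝ) (a b : ParaOctonion) : (r • a) * b = r • (a * b) := by
  apply ext' <;> simp [fst_mul, snd_mul, fst_smul, snd_smul]

theorem mul_smul' (r : ℝ) (a b : ParaOctonion) : a * (r • b) = r • (a * b) := by
  apply ext' <;> simp [fst_mul, snd_mul, fst_smul, snd_smul]

theorem mul_mul_conj (a b : ParaOctonion) : (a * b) * conj b = nsq b • a := by
  rw [nsq_eq]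
  apply ext' <;> simp [fst_mul, snd_mul, fst_conj, snd_conj, fst_smul, snd_smul] <;> ring

theorem mul_conj_mul (a b : ParaOctonion) : (a * conj b) * b = nsq b • a := by
  rw [nsq_eq]
  apply ext' <;> simp [fst_mul, snd_mul, fst_conj, snd_conj, fst_smul, snd_smul] <;> ring

theorem conj_conj (a : ParaOctonion) : conj (conj a) = a := by
  apply ext' <;> simp [fst_conj, snd_conj]

theorem conj_add (a b : ParaOctonion) : conj (a + b) = conj a + conj b := by
  apply ext' <;> simp [fst_conj, snd_conj, fst_add, snd_add] <;> ring

theorem conj_smul (r : ℝ) (a : ParaOctonion) : conj (r • a) = r • conj a := by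
  apply ext' <;> simp [fst_conj, snd_conj, fst_smul, snd_smul]

theorem conj_mul (a b : ParaOctonion) : conj (a * b) = conj b * conj a := by
  apply ext' <;> simp [fst_mul, snd_mul, fst_conj, snd_conj]

theorem nsq_mul (a b : ParaOctonion) : nsq (a * b) = nsq a * nsq b := by
  simp only [nsq_eq, fst_mul, snd_mul]
  simp
  ring

theorem nsq_conj (a : ParaOctonion) : nsq (conj a) = nsq a := by
  simp [nsq_eq, fst_conj, snd_conj]

theorem nsq_smul (r : ℝ) (a : ParaOctonion) : nsq (r • a) = r ^ 2 * nsq a := by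
  simp [nsq_eq, fst_smul, snd_smul]; ring

theorem nsq_one : nsq 1 = 1 := by simp [nsq_eq, fst_one, snd_one]

theorem nsq_zero : nsq 0 = 0 := by simp [nsq_eq, fst_zero, snd_zero]

theorem conj_one : conj 1 = 1 := by apply ext' <;> simp [fst_conj, snd_conj, fst_one, snd_one]

theorem inv_one : inv 1 = 1 := by simp [inv, nsq_one, conj_one]

theorem nsq_inv {a : ParaOctonion} (h : 0 < nsq a) : nsq (inv a) = (nsq a)⁻¹ := by
  rw [inv, nsq_smul, nsq_conj]; field_simp

theorem mul_mul_inv (a : ParaOctonion) {b : ParaOctonion} (h : 0 < nsq b) :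
    (a * b) * inv b = a := by
  rw [inv, mul_smul', mul_mul_conj, smul_smul, inv_mul_cancel₀ h.ne', one_smul]

theorem mul_inv_mul (a : ParaOctonion) {b : ParaOctonion} (h : 0 < nsq b) :
    (a * inv b) * b = a := by
  rw [inv, mul_smul', smul_mul', mul_conj_mul, smul_smul, inv_mul_cancel₀ h.ne', one_smul]

theorem mul_inv' {b : ParaOctonion} (h : 0 < nsq b) : b * inv b = 1 := by
  simpa [one_mul'] using mul_mul_inv 1 h

theorem inv_mul' {b : ParaOctonion} (h : 0 < nsq b) : inv b * b = 1 := by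
  simpa [one_mul'] using mul_inv_mul 1 h

theorem inv_nsq_pos {a : ParaOctonion} (h : 0 < nsq a) : 0 < nsq (inv a) := by
  rw [nsq_inv h]; positivity

/-- The inner product is bilinear; needed to regard the metric as a tensor field. -/
theorem ip_add_left (a b c : ParaOctonion) : ip (a + b) c = ip a c + ip b c := by
  simp [ip_eq, fst_add, snd_add]; ring
theorem ip_add_right (a b c : ParaOctonion) : ip a (b + c) = ip a b + ip a c := by
  simp [ip_eq, fst_add, snd_add]; ring
theorem ip_smul_left (r : ℝ) (a c : ParaOctonion) : ip (r • a) c = r * ip a c := by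
  simp [ip_eq, fst_smul, snd_smul]; ring
theorem ip_smul_right (r : ℝ) (a c : ParaOctonion) : ip a (r • c) = r * ip a c := by
  simp [ip_eq, fst_smul, snd_smul]; ring

theorem ip_comm (a b : ParaOctonion) : ip a b = ip b a := by
  simp only [ip_eq]; ring

theorem ip_conj_conj (a b : ParaOctonion) : ip (conj a) (conj b) = ip a b := by
  simp [ip_eq, fst_conj, snd_conj]

theorem ip_mul_conj_left (a b c : ParaOctonion) : ip (a * conj b) c = ip a (c * b) := by
  simp only [ip_eq, fst_mul, snd_mul, fst_conj, snd_conj]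
  simp
  ring

theorem ip_mul_mul_right (a b c : ParaOctonion) : ip (a * c) (b * c) = nsq c * ip a b := by
  rw [← ip_mul_conj_left, mul_mul_conj, ip_smul_left]

theorem ip_mul_mul_left (a b c : ParaOctonion) : ip (c * a) (c * b) = nsq c * ip a b := by
  rw [← ip_conj_conj, conj_mul, conj_mul, ip_mul_mul_right, nsq_conj, ip_conj_conj]

theorem nsq_add (a b : ParaOctonion) : nsq (a + b) = nsq a + 2 * ip a b + nsq b := by
  simp only [nsq, ip_add_left, ip_add_right, ip_comm b a]; ring

/-- Polarization of `|a b|² = |a|² |b|²` in both arguments. -/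
theorem ip_exchange (a b c d : ParaOctonion) :
    ip (a * b) (c * d) + ip (a * d) (c * b) = 2 * ip a c * ip b d := by
  have h := ip_mul_mul_right a c (b + d)
  simp only [mul_add', ip_add_left, ip_add_right, ip_mul_mul_right, nsq_add] at h
  linarith

end ParaOctonion

open ParaOctonion

namespace ParaOctonionicPlane

/-- `U i` consists of the triples with `i`-th coordinate `1` and `|x|² + |y|² + |z|² > 0`. -/
def U (i : Fin 3) : Set (Fin 3 → ParaOctonion) := {p | p i = 1 ∧ 0 < ∑ j, nsq (p j)}

/-- The set of reduced homogeneous coordinates. -/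
def reduced : Set (Fin 3 → ParaOctonion) := ⋃ i, U i

/-- `p ∼ q` iff `p = q λ` for some para-octonion `λ` with `|λ|² > 0`. -/
def Rel (p q : Fin 3 → ParaOctonion) : Prop :=
  ∃ l : ParaOctonion, 0 < nsq l ∧ ∀ i, p i = q i * l

theorem mem_reduced {p : Fin 3 → ParaOctonion} :
    p ∈ reduced ↔ (∃ i, p i = 1) ∧ 0 < ∑ j, nsq (p j) := by
  simp [reduced, U]

theorem Rel.refl (p : Fin 3 → ParaOctonion) : Rel p p :=
  ⟨1, by simp [nsq_one], fun i => (mul_one' _).symm⟩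

theorem Rel.symm {p q : Fin 3 → ParaOctonion} (h : Rel p q) : Rel q p := by
  obtain ⟨l, hl, h⟩ := h
  exact ⟨inv l, inv_nsq_pos hl, fun i => by rw [h, mul_mul_inv _ hl]⟩

theorem Rel.eq_of_eq_one {p q : Fin 3 → ParaOctonion} (h : Rel p q) {i : Fin 3}
    (hp : p i = 1) (hq : q i = 1) : p = q := by
  obtain ⟨l, -, h⟩ := h
  have : l = 1 := by rw [← hp, h, hq, one_mul']
  funext j
  rw [h, this, mul_one']

theorem Rel.trans {p q r : Fin 3 → ParaOctonion} (hp : p ∈ reduced) (hq : q ∈ reduced)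
    (hr : r ∈ reduced) (h : Rel p q) (h' : Rel q r) : Rel p r := by
  obtain ⟨⟨i, hi⟩, -⟩ := mem_reduced.1 hp
  obtain ⟨⟨j, hj⟩, -⟩ := mem_reduced.1 hq
  obtain ⟨⟨k, hk⟩, -⟩ := mem_reduced.1 hr
  by_cases hij : i = j
  · subst hij; rwa [h.eq_of_eq_one hi hj]
  by_cases hjk : j = k
  · subst hjk; rwa [← h'.eq_of_eq_one hj hk]
  obtain ⟨l, hl, h⟩ := h
  obtain ⟨m, hm, h'⟩ := h'
  have hri : (r i * m) * l = 1 := by rw [← h', ← h, hi]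
  have hrj : r j * m = 1 := by rw [← h', hj]
  have hrjm : r j = inv m := by rw [← one_mul' (inv m), ← hrj, mul_mul_inv _ hm]
  have hrim : r i * m = inv l := by rw [← one_mul' (inv l), ← hri, mul_mul_inv _ hl]
  by_cases hik : i = k
  · subst hik
    refine ⟨1, by simp [nsq_one], fun n => ?_⟩
    rw [hk, one_mul'] at hri
    rw [hk, one_mul'] at hrim
    rw [h, h', mul_one', hrim, mul_inv_mul _ hl]
  refine ⟨m * l, by rw [nsq_mul]; positivity, fun n => ?_⟩
  have hn : n = i ∨ n = j ∨ n = k := by omega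
  rw [h, h']
  rcases hn with rfl | rfl | rfl
  · rw [hri]
    have h1 : r n = inv (m * l) := by
      rw [← mul_mul_inv (r n) hm, hrim, inv, inv, inv, conj_mul, nsq_mul, mul_smul', smul_mul',
        smul_smul, mul_inv]
    rw [h1, inv_mul' (by rw [nsq_mul]; positivity)]
  · rw [hrj, hrjm, one_mul']
    have := mul_mul_conj (conj l) (conj m)
    rw [conj_conj, ← conj_mul, nsq_conj] at this
    have := congrArg conj this
    rw [conj_mul, conj_conj] at this
    rw [inv, smul_mul', this]
    have e : conj (nsq m • conj l) = nsq m • l := by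
      apply ext' <;> simp [fst_conj, snd_conj, fst_smul, snd_smul]
    rw [e, smul_smul, inv_mul_cancel₀ hm.ne', one_smul]
  · rw [hk, one_mul', one_mul']

end ParaOctonionicPlane

open ParaOctonionicPlane in
/-- `∼` is an equivalence relation on reduced triples. -/
instance ParaOctonionicPlane.setoid : Setoid reduced where
  r p q := Rel p.1 q.1
  iseqv := ⟨fun p => Rel.refl p.1, fun h => h.symm, fun {p q r} h h' =>
    Rel.trans p.2 q.2 r.2 h h'⟩

/-- The para-octonionic projective plane, with the quotient topology. -/
def ParaOctonionicPlane : Type := Quotient ParaOctonionicPlane.setoid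

namespace ParaOctonionicPlane

instance : TopologicalSpace ParaOctonionicPlane :=
  inferInstanceAs (TopologicalSpace (Quotient ParaOctonionicPlane.setoid))

/-- The class `[x, y, z]` of a reduced triple. -/
def mk (p : reduced) : ParaOctonionicPlane := Quotient.mk setoid p

theorem isQuotientMap_mk : Topology.IsQuotientMap mk := isQuotientMap_quotient_mk'

theorem mk_surjective : Function.Surjective mk := Quotient.mk_surjective

theorem mk_eq_mk {p q : reduced} : mk p = mk q ↔ Rel p.1 q.1 := Quotient.eq (r := setoid)

/-- The coordinate space `𝕆' × 𝕆'`, of real dimension `16`. -/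
abbrev Model : Type := ParaOctonion × ParaOctonion

/-- Multiplication as a bilinear map. -/
def mulL : ParaOctonion →L[ℝ] ParaOctonion →L[ℝ] ParaOctonion :=
  (LinearMap.mk₂ ℝ (fun a b : ParaOctonion => a * b) add_mul' smul_mul' mul_add'
    mul_smul').toContinuousBilinearMap

/-- The inner product as a bilinear form. -/
def ipL : ParaOctonion →L[ℝ] ParaOctonion →L[ℝ] ℝ :=
  (LinearMap.mk₂ ℝ ip ip_add_left ip_smul_left ip_add_right
    ip_smul_right).toContinuousBilinearMap

/-- Conjugation as a linear map. -/
def conjL : ParaOctonion →L[ℝ] ParaOctonion :=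
  LinearMap.toContinuousLinearMap
    { toFun := conj, map_add' := conj_add, map_smul' := conj_smul }

theorem contDiff_mul : ContDiff ℝ ∞ (fun x : ParaOctonion × ParaOctonion => x.1 * x.2) :=
  mulL.isBoundedBilinearMap.contDiff

theorem contDiff_nsq : ContDiff ℝ ∞ nsq :=
  ipL.isBoundedBilinearMap.contDiff.comp (contDiff_id.prodMk contDiff_id)

theorem contDiffAt_inv {a : ParaOctonion} (h : 0 < nsq a) : ContDiffAt ℝ ∞ inv a :=
  (contDiff_nsq.contDiffAt.inv h.ne').smul conjL.contDiff.contDiffAt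

theorem continuous_nsq : Continuous nsq := contDiff_nsq.continuous

/-- The open set `1 + |u|² + |v|² > 0`. -/
def domain : Set Model := {x | 0 < 1 + nsq x.1 + nsq x.2}

/-- The triple with `1` in position `i` and `u`, `v` in the remaining positions, in this order. -/
def insertOne (i : Fin 3) (x : Model) : Fin 3 → ParaOctonion :=
  i.insertNth (α := fun _ => ParaOctonion) 1 ![x.1, x.2]

theorem insertOne_mem_U {i : Fin 3} {x : Model} (hx : x ∈ domain) : insertOne i x ∈ U i := by
  refine ⟨by simp [insertOne], ?_⟩
  rw [Fin.sum_univ_succAbove _ i]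
  simpa [insertOne, nsq_one, ← add_assoc, domain] using hx

theorem insertOne_mem {i : Fin 3} {x : Model} (hx : x ∈ domain) : insertOne i x ∈ reduced :=
  Set.mem_iUnion.2 ⟨i, insertOne_mem_U hx⟩

/-- Affine coordinates of a triple: divide by the `i`-th entry on the right. -/
def affine (i : Fin 3) (p : Fin 3 → ParaOctonion) : Model :=
  (p (i.succAbove 0) * inv (p i), p (i.succAbove 1) * inv (p i))

theorem insertOne_affine {i : Fin 3} {p : Fin 3 → ParaOctonion} (h : 0 < nsq (p i)) :
    insertOne i (affine i p) = fun j => p j * inv (p i) := by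
  funext j
  refine Fin.succAboveCases i ?_ (fun k => ?_) j
  · simp [insertOne, mul_inv' h]
  · fin_cases k <;> simp [insertOne, affine]

theorem affine_mem {i : Fin 3} {p : Fin 3 → ParaOctonion} (h : 0 < nsq (p i))
    (hp : p ∈ reduced) : affine i p ∈ domain := by
  have h1 := (mem_reduced.1 hp).2
  rw [Fin.sum_univ_succAbove _ i, Fin.sum_univ_two] at h1
  have : 1 + nsq (affine i p).1 + nsq (affine i p).2 =
      (nsq (p i))⁻¹ * (nsq (p i) + (nsq (p (i.succAbove 0)) + nsq (p (i.succAbove 1)))) := by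
    simp only [affine, nsq_mul, nsq_inv h]
    field_simp
    ring
  rw [domain, Set.mem_ofPred_eq, this]
  positivity

theorem rel_insertOne_affine {i : Fin 3} {p : Fin 3 → ParaOctonion} (h : 0 < nsq (p i)) :
    Rel (insertOne i (affine i p)) p :=
  ⟨inv (p i), inv_nsq_pos h, fun j => by rw [insertOne_affine h]⟩

theorem affine_insertOne (i : Fin 3) (x : Model) : affine i (insertOne i x) = x := by
  simp [affine, insertOne, inv_one, mul_one']

theorem Rel.nsq_pos_iff {p q : Fin 3 → ParaOctonion} (h : Rel p q) (i : Fin 3) :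
    0 < nsq (p i) ↔ 0 < nsq (q i) := by
  obtain ⟨l, hl, h⟩ := h
  rw [h, nsq_mul, mul_pos_iff_of_pos_right hl]

theorem Rel.affine_eq {p q : Fin 3 → ParaOctonion} (h : Rel p q) (hp : p ∈ reduced)
    (hq : q ∈ reduced) {i : Fin 3} (hi : 0 < nsq (p i)) : affine i p = affine i q := by
  have hi' := (h.nsq_pos_iff i).1 hi
  have mp := insertOne_mem (i := i) (affine_mem hi hp)
  have mq := insertOne_mem (i := i) (affine_mem hi' hq)
  have h1 : Rel (insertOne i (affine i p)) (insertOne i (affine i q)) :=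
    Rel.trans mp hq mq (Rel.trans mp hp hq (rel_insertOne_affine hi) h)
      (rel_insertOne_affine hi').symm
  have h2 := h1.eq_of_eq_one (i := i) (by simp [insertOne]) (by simp [insertOne])
  rw [← affine_insertOne i (affine i p), h2, affine_insertOne]

/-- `U i / ∼`. -/
def chartSource (i : Fin 3) : Set ParaOctonionicPlane :=
  {P | ∃ p : reduced, p.1 ∈ U i ∧ mk p = P}

theorem mk_mem_chartSource {i : Fin 3} {p : reduced} :
    mk p ∈ chartSource i ↔ 0 < nsq (p.1 i) := by
  constructor
  · rintro ⟨q, hq, h⟩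
    have h : Rel q.1 p.1 := mk_eq_mk.1 h
    rw [← h.nsq_pos_iff i, hq.1, nsq_one]
    exact one_pos
  · intro h
    exact ⟨⟨_, insertOne_mem (i := i) (affine_mem h p.2)⟩, insertOne_mem_U (affine_mem h p.2),
      mk_eq_mk.2 (rel_insertOne_affine h)⟩

open Classical in
/-- The coordinates `[x, y, z] ↦ (y, z), (x, z), (x, y)` on the respective `U i / ∼`: pass to the
representative in `U i` and drop the entry `1`. The value off `U i / ∼` is irrelevant. -/
def chartFun (i : Fin 3) : ParaOctonionicPlane → Model :=
  Quotient.lift (fun p : reduced => if 0 < nsq (p.1 i) then affine i p.1 else 0) (by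
    intro p q (h : Rel p.1 q.1)
    by_cases hi : 0 < nsq (p.1 i)
    · simp [hi, (h.nsq_pos_iff i).1 hi, h.affine_eq p.2 q.2 hi]
    · simp [hi, (h.nsq_pos_iff i).not.1 hi])

theorem chartFun_mk {i : Fin 3} {p : reduced} (h : 0 < nsq (p.1 i)) :
    chartFun i (mk p) = affine i p.1 := if_pos h

theorem zero_mem_domain : (0 : Model) ∈ domain := by simp [domain, nsq_zero]

open Classical in
/-- The inverse coordinates `(u, v) ↦ [1, u, v], [u, 1, v], [u, v, 1]`. The value off the domain is
irrelevant. -/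
def chartInv (i : Fin 3) (x : Model) : ParaOctonionicPlane :=
  if hx : x ∈ domain then mk ⟨insertOne i x, insertOne_mem hx⟩
  else mk ⟨insertOne i 0, insertOne_mem zero_mem_domain⟩

theorem chartInv_of_mem {i : Fin 3} {x : Model} (hx : x ∈ domain) :
    chartInv i x = mk ⟨insertOne i x, insertOne_mem hx⟩ := dif_pos hx

theorem isOpen_domain : IsOpen domain :=
  isOpen_lt continuous_const (by
    exact (continuous_const.add (continuous_nsq.comp continuous_fst)).add
      (continuous_nsq.comp continuous_snd))

theorem continuous_insertOne (i : Fin 3) : Continuous (insertOne i) := by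
  refine continuous_pi fun j => ?_
  refine Fin.succAboveCases i ?_ (fun k => ?_) j
  · simpa [insertOne] using continuous_const
  · fin_cases k <;> simp [insertOne] <;> fun_prop

theorem contDiffAt_affine (i : Fin 3) {p : Fin 3 → ParaOctonion} (h : 0 < nsq (p i)) :
    ContDiffAt ℝ ∞ (affine i) p := by
  have hi : ContDiffAt ℝ ∞ (fun p : Fin 3 → ParaOctonion => inv (p i)) p :=
    (contDiffAt_inv h).comp p (contDiff_apply ℝ ParaOctonion i).contDiffAt
  exact (contDiff_mul.contDiffAt.comp p
    ((contDiff_apply ℝ ParaOctonion (i.succAbove 0)).contDiffAt.prodMk hi)).prodMk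
    (contDiff_mul.contDiffAt.comp p
    ((contDiff_apply ℝ ParaOctonion (i.succAbove 1)).contDiffAt.prodMk hi))

/-- The `i`-th chart of the atlas. -/
def chart (i : Fin 3) : OpenPartialHomeomorph ParaOctonionicPlane Model where
  toFun := chartFun i
  invFun := chartInv i
  source := chartSource i
  target := domain
  map_source' := by
    rintro P hP
    obtain ⟨p, rfl⟩ := mk_surjective P
    have h := mk_mem_chartSource.1 hP
    rw [chartFun_mk h]
    exact affine_mem h p.2
  map_target' := by
    intro x hx
    rw [chartInv_of_mem hx]
    exact ⟨_, insertOne_mem_U hx, rfl⟩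
  left_inv' := by
    rintro P hP
    obtain ⟨p, rfl⟩ := mk_surjective P
    have h := mk_mem_chartSource.1 hP
    rw [chartFun_mk h, chartInv_of_mem (affine_mem h p.2)]
    exact mk_eq_mk.2 (rel_insertOne_affine h)
  right_inv' := by
    intro x hx
    rw [chartInv_of_mem hx, chartFun_mk (by simp [insertOne, nsq_one]), affine_insertOne]
  open_source := by
    rw [← isQuotientMap_mk.isOpen_preimage]
    have : mk ⁻¹' (chartSource i) = {p : reduced | 0 < nsq (p.1 i)} := by
      ext p; exact mk_mem_chartSource
    rw [this]
    exact isOpen_lt continuous_const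
      (continuous_nsq.comp ((continuous_apply i).comp continuous_subtype_val))
  open_target := isOpen_domain
  continuousOn_toFun := by
    have hs : mk ⁻¹' (chartSource i) = {p : reduced | 0 < nsq (p.1 i)} := by
      ext p; exact mk_mem_chartSource
    have ho : IsOpen {p : reduced | 0 < nsq (p.1 i)} := isOpen_lt continuous_const
      (continuous_nsq.comp ((continuous_apply i).comp continuous_subtype_val))
    rw [isQuotientMap_mk.continuousOn_isOpen_iff
      (by rw [← isQuotientMap_mk.isOpen_preimage, hs]; exact ho), hs]
    have : ContinuousOn (fun p : reduced => affine i p.1) {p : reduced | 0 < nsq (p.1 i)} :=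
      fun p hp => ((contDiffAt_affine i hp).continuousAt.comp
        continuous_subtype_val.continuousAt).continuousWithinAt
    exact this.congr fun p hp => chartFun_mk hp
  continuousOn_invFun := by
    rw [continuousOn_iff_continuous_domRestrict]
    have : Continuous fun x : domain => mk ⟨insertOne i x.1, insertOne_mem x.2⟩ :=
      isQuotientMap_mk.continuous.comp
        (((continuous_insertOne i).comp continuous_subtype_val).subtype_mk _)
    exact this.congr fun x => (chartInv_of_mem x.2).symm

theorem chart_apply (i : Fin 3) (P : ParaOctonionicPlane) : (chart i) P = chartFun i P := rfl

theorem chart_symm_apply (i : Fin 3) (x : Model) : (chart i).symm x = chartInv i x := rfl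

theorem chart_source (i : Fin 3) : (chart i).source = chartSource i := rfl

theorem chart_target (i : Fin 3) : (chart i).target = domain := rfl

theorem exists_mem_chartSource (P : ParaOctonionicPlane) : ∃ i, P ∈ chartSource i := by
  obtain ⟨p, rfl⟩ := mk_surjective P
  obtain ⟨i, hi⟩ := Set.mem_iUnion.1 p.2
  exact ⟨i, p, hi, rfl⟩

open Classical in
/-- The first index `i` with `P ∈ U i / ∼`. -/
def chartIndex (P : ParaOctonionicPlane) : Fin 3 :=
  Fin.find (fun i => P ∈ chartSource i) (exists_mem_chartSource P)

open Classical in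
theorem mem_chartIndex (P : ParaOctonionicPlane) : P ∈ chartSource (chartIndex P) :=
  Fin.find_spec (exists_mem_chartSource P)

/-- The atlas of the three charts. The preferred chart at a point is the first one around it. -/
instance : ChartedSpace Model ParaOctonionicPlane where
  atlas := Set.range chart
  chartAt P := chart (chartIndex P)
  mem_chart_source := mem_chartIndex
  chart_mem_atlas _ := ⟨_, rfl⟩

theorem chart_mem_atlas (i : Fin 3) : chart i ∈ atlas Model ParaOctonionicPlane := ⟨i, rfl⟩

theorem contDiff_insertOne (i : Fin 3) : ContDiff ℝ ∞ (insertOne i) := by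
  refine contDiff_pi.2 fun j => ?_
  refine Fin.succAboveCases i ?_ (fun k => ?_) j
  · simpa [insertOne] using contDiff_const
  · fin_cases k <;> simp [insertOne] <;> fun_prop

/-- The coordinate change from the `i`-th to the `j`-th chart. -/
theorem chart_chart_symm {i j : Fin 3} {x : Model} (hx : x ∈ domain)
    (hj : 0 < nsq (insertOne i x j)) : chart j ((chart i).symm x) = affine j (insertOne i x) := by
  rw [chart_apply, chart_symm_apply, chartInv_of_mem hx,
    chartFun_mk (p := ⟨insertOne i x, insertOne_mem hx⟩) hj]

theorem chart_symm_mem {i j : Fin 3} {x : Model} (hx : x ∈ domain) :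
    (chart i).symm x ∈ (chart j).source ↔ 0 < nsq (insertOne i x j) := by
  rw [chart_symm_apply, chart_source, chartInv_of_mem hx, mk_mem_chartSource]

instance : IsManifold 𝓘(ℝ, Model) ∞ ParaOctonionicPlane := by
  apply isManifold_of_contDiffOn
  rintro _ _ ⟨i, rfl⟩ ⟨j, rfl⟩ x hx
  have hx1 : x ∈ domain ∧ (chart i).symm x ∈ (chart j).source := by
    simpa [chart_target] using hx
  have hj := (chart_symm_mem hx1.1).1 hx1.2
  have h1 : ContDiffAt ℝ ∞ (fun x => affine j (insertOne i x)) x :=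
    (contDiffAt_affine j hj).comp x (contDiff_insertOne i).contDiffAt
  refine h1.contDiffWithinAt.congr_of_mem (fun y hy => ?_) hx
  have hy1 : y ∈ domain ∧ (chart i).symm y ∈ (chart j).source := by
    simpa [chart_target] using hy
  simpa using chart_chart_symm hy1.1 ((chart_symm_mem hy1.1).1 hy1.2)

end ParaOctonionicPlane

/-! Curvature of a semi-Riemannian metric, computed in a chart. -/

namespace SemiRiemannian

variable {E : Type*} [NormedAddCommGroup E] [NormedSpace ℝ E]

/-- The Christoffel symbols of the first kind of a metric `G` on an open subset of `E`:
`z ↦ ½ (∂_v G(w, z) + ∂_w G(v, z) - ∂_z G(v, w))`. -/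
def christoffelLower (G : E → E →L[ℝ] E →L[ℝ] ℝ) (x v w : E) : E →L[ℝ] ℝ :=
  (1 / 2 : ℝ) • (fderiv ℝ G x v w + fderiv ℝ G x w v - ((fderiv ℝ G x).flip v).flip w)

/-- The Christoffel symbols of the second kind, i.e. the vector `Γ(v, w)` with
`G(Γ(v, w), z) = christoffelLower G x v w z` for all `z`; the Levi-Civita connection is
`∇_v W = ∂_v W + Γ(v, W)`. -/
def christoffel (G : E → E →L[ℝ] E →L[ℝ] ℝ) (x v w : E) : E :=
  (G x).inverse (christoffelLower G x v w)

/-- The curvature operator, with the sign convention `R(X, Y) Z = ∇_Y ∇_X Z - ∇_X ∇_Y Z` for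
coordinate vector fields, i.e. `R_{αβγ}^δ = Γ_{αγ;β}^δ - Γ_{βγ;α}^δ + (terms quadratic in Γ)`. -/
def coordCurvature (G : E → E →L[ℝ] E →L[ℝ] ℝ) (x X Y Z : E) : E :=
  fderiv ℝ (fun y => christoffel G y X Z) x Y - fderiv ℝ (fun y => christoffel G y Y Z) x X
    + christoffel G x Y (christoffel G x X Z) - christoffel G x X (christoffel G x Y Z)

variable {M : Type*} [TopologicalSpace M] [ChartedSpace E M]

/-- The coordinate expression of a field of bilinear forms in a chart `e`. -/
def inChart (g : ∀ p : M, TangentSpace 𝓘(ℝ, E) p →L[ℝ] TangentSpace 𝓘(ℝ, E) p →L[ℝ] ℝ)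
    (e : OpenPartialHomeomorph M E) (x : E) : E →L[ℝ] E →L[ℝ] ℝ :=
  let B : E →L[ℝ] E →L[ℝ] ℝ := g (e.symm x)
  let d : E →L[ℝ] E := mfderiv 𝓘(ℝ, E) 𝓘(ℝ, E) e.symm x
  B.bilinearComp d d

/-- The Riemann curvature tensor `R(X, Y, Z, W) = g(R(X, Y) Z, W)` at a point `p`, computed in the
preferred chart at `p`. -/
def riemannTensor (g : ∀ p : M, TangentSpace 𝓘(ℝ, E) p →L[ℝ] TangentSpace 𝓘(ℝ, E) p →L[ℝ] ℝ)
    (p : M) (X Y Z W : TangentSpace 𝓘(ℝ, E) p) : ℝ :=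
  let e := chartAt E p
  let d : TangentSpace 𝓘(ℝ, E) p →L[ℝ] E := mfderiv 𝓘(ℝ, E) 𝓘(ℝ, E) e p
  inChart g e (e p) (coordCurvature (inChart g e) (e p) (d X) (d Y) (d Z)) (d W)

end SemiRiemannian

namespace ParaOctonionicPlane

/-- The line element
`ds² = (|du|² (1 + |v|²) + |dv|² (1 + |u|²) - 2 Re((u v̄)(dv dū))) / (1 + |u|² + |v|²)²`
at `x = (u, v)`, evaluated on `X = (du, dv)`. -/
def lineElement (x X : Model) : ℝ :=
  (nsq X.1 * (1 + nsq x.2) + nsq X.2 * (1 + nsq x.1)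
    - 2 * re ((x.1 * conj x.2) * (X.2 * conj X.1))) / (1 + nsq x.1 + nsq x.2) ^ 2

theorem re_add (a b : ParaOctonion) : re (a + b) = re a + re b := rfl

theorem re_smul (r : ℝ) (a : ParaOctonion) : re (r • a) = r * re a := rfl

/-- The symmetric bilinear form with quadratic form `ds²`. -/
def coordForm (x : Model) : Model →L[ℝ] Model →L[ℝ] ℝ :=
  (LinearMap.mk₂ ℝ (fun X Y : Model =>
    (ip X.1 Y.1 * (1 + nsq x.2) + ip X.2 Y.2 * (1 + nsq x.1)
      - re ((x.1 * conj x.2) * (X.2 * conj Y.1)) - re ((x.1 * conj x.2) * (Y.2 * conj X.1)))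
      / (1 + nsq x.1 + nsq x.2) ^ 2)
    (by
      intro X X' Y
      simp only [Prod.fst_add, Prod.snd_add, ip_add_left, add_mul', mul_add', conj_add, re_add]
      ring)
    (by
      intro r X Y
      simp only [Prod.smul_fst, Prod.smul_snd, ip_smul_left, smul_mul', mul_smul', conj_smul,
        re_smul, smul_eq_mul]
      ring)
    (by
      intro X Y Y'
      simp only [Prod.fst_add, Prod.snd_add, ip_add_right, add_mul', mul_add', conj_add, re_add]
      ring)
    (by
      intro r X Y
      simp only [Prod.smul_fst, Prod.smul_snd, ip_smul_right, smul_mul', mul_smul', conj_smul,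
        re_smul, smul_eq_mul]
      ring)).toContinuousBilinearMap

theorem coordForm_apply (x X Y : Model) : coordForm x X Y =
    (ip X.1 Y.1 * (1 + nsq x.2) + ip X.2 Y.2 * (1 + nsq x.1)
      - re ((x.1 * conj x.2) * (X.2 * conj Y.1)) - re ((x.1 * conj x.2) * (Y.2 * conj X.1)))
      / (1 + nsq x.1 + nsq x.2) ^ 2 := rfl

theorem coordForm_self (x X : Model) : coordForm x X X = lineElement x X := by
  rw [coordForm_apply, lineElement, nsq.eq_def X.1, nsq.eq_def X.2]; ring

theorem coordForm_symm (x X Y : Model) : coordForm x X Y = coordForm x Y X := by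
  rw [coordForm_apply, coordForm_apply, ip_comm X.1, ip_comm X.2]; ring

/-- The metric on `U i / ∼` given by `ds²` in the coordinates `(u, v)` of the `i`-th chart. -/
def chartMetric (i : Fin 3) (P : ParaOctonionicPlane) :
    TangentSpace 𝓘(ℝ, Model) P →L[ℝ] TangentSpace 𝓘(ℝ, Model) P →L[ℝ] ℝ :=
  let d : Model →L[ℝ] Model := mfderiv 𝓘(ℝ, Model) 𝓘(ℝ, Model) (chart i) P
  show Model →L[ℝ] Model →L[ℝ] ℝ from (coordForm (chart i P)).bilinearComp d d

/-- The metric of the para-octonionic projective plane. -/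
def metric (P : ParaOctonionicPlane) :
    TangentSpace 𝓘(ℝ, Model) P →L[ℝ] TangentSpace 𝓘(ℝ, Model) P →L[ℝ] ℝ :=
  chartMetric (chartIndex P) P

/-! The metrics on the three charts agree on the overlaps. -/

theorem re_mul_eq_ip (a b c d : ParaOctonion) :
    re ((a * conj b) * (c * conj d)) = ip (b * conj a) (c * conj d) := by
  rw [ip_comm, ip, conj_mul, conj_conj]
  have (p q : ParaOctonion) : re (p * q) = re (q * p) := by
    simp [re, fst_mul]; ring
  exact this _ _

theorem lineElement_swap (x X : Model) : lineElement x.swap X.swap = lineElement x X := by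
  simp only [lineElement, re_mul_eq_ip, Prod.fst_swap, Prod.snd_swap]
  rw [← ip_conj_conj (x.1 * _), conj_mul, conj_mul, conj_conj, conj_conj]
  ring

/-- The coordinate change `(x, z) ↦ (x⁻¹, z x⁻¹)`. -/
def transition (x : Model) : Model := (inv x.1, x.2 * inv x.1)

/-- The differential of the coordinate change. -/
def dtransition (x X : Model) : Model :=
  ((nsq x.1)⁻¹ • conj X.1 - (2 * ip x.1 X.1 * (nsq x.1 ^ 2)⁻¹) • conj x.1,
    X.2 * inv x.1 + x.2 *
      ((nsq x.1)⁻¹ • conj X.1 - (2 * ip x.1 X.1 * (nsq x.1 ^ 2)⁻¹) • conj x.1))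

theorem lineElement_transition {x : Model} (hx : 0 < nsq x.1) (hd : x ∈ domain) (X : Model) :
    lineElement (transition x) (dtransition x X) = lineElement x X := by
  obtain ⟨x, z⟩ := x
  obtain ⟨dx, dz⟩ := X
  simp only [lineElement, re_mul_eq_ip, transition, dtransition] at *
  set n := nsq x with hn
  set s := ip x dx with hs
  have hd' : 0 < 1 + n + nsq z := hd
  have hsub (a b : ParaOctonion) : a - b = a + (-1 : ℝ) • b := by simp [sub_eq_add_neg]
  have e1 : nsq (inv x) = n⁻¹ := nsq_inv hx
  have e2 : z * inv x * conj (inv x) = n⁻¹ • z := by rw [mul_mul_conj, e1]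
  have ex := ip_exchange dz (conj x) z (conj dx)
  rw [ip_conj_conj, ← hs] at ex
  have ex2 : ip (dz * conj x) (z * conj dx) = 2 * ip dz z * s - ip (z * conj x) (dz * conj dx) := by
    rw [ip_comm (z * conj x)]; linarith
  set c := ip (z * conj x) (dz * conj dx) with hc
  have e3 : nsq (n⁻¹ • conj dx - (2 * s * (n ^ 2)⁻¹) • conj x) = nsq dx * (n ^ 2)⁻¹ := by
    rw [hsub, nsq_add, nsq_smul, nsq_smul, nsq_smul, nsq_conj, nsq_conj, ip_smul_left,
      ip_smul_right, ip_smul_right, ip_conj_conj, ip_comm, ← hs, ← hn]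
    field_simp; ring
  set du := n⁻¹ • conj dx - (2 * s * (n ^ 2)⁻¹) • conj x with hdu
  have h1 : nsq (dz * inv x) = nsq dz * n⁻¹ := by rw [nsq_mul, e1]
  have h2 : nsq (z * du) = nsq z * (nsq dx * (n ^ 2)⁻¹) := by rw [nsq_mul, e3]
  have h3 : ip (dz * inv x) (z * du) = - c * (n ^ 2)⁻¹ := by
    rw [hdu, hsub, mul_add', inv, ← hn]
    simp only [mul_smul', ip_add_right, ip_smul_right, ip_smul_left, ex2, ip_mul_mul_right,
      nsq_conj, ← hn]
    field_simp; ring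
  have h4 : nsq (dz * inv x + z * du) =
      nsq dz * n⁻¹ + nsq z * (nsq dx * (n ^ 2)⁻¹) - 2 * c * (n ^ 2)⁻¹ := by
    rw [nsq_add, h1, h2, h3]; ring
  have h5 : ip (n⁻¹ • z) ((dz * inv x + z * du) * conj du) =
      n⁻¹ * (nsq z * (nsq dx * (n ^ 2)⁻¹) - c * (n ^ 2)⁻¹) := by
    rw [ip_smul_left, ip_comm, ip_mul_conj_left, ip_add_left, h3]
    have : ip (z * du) (z * du) = nsq z * (nsq dx * (n ^ 2)⁻¹) := h2
    rw [this]; ring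
  have h6 : 1 + n⁻¹ + nsq z * n⁻¹ = (1 + n + nsq z) * n⁻¹ := by field_simp; ring
  rw [e2, h5, h4, e3, nsq_mul, e1, h6]
  have h7 := hd'.ne'
  field_simp
  ring

theorem hasFDerivAt_inv {a : ParaOctonion} (h : 0 < nsq a) :
    HasFDerivAt inv ((nsq a)⁻¹ • conjL
      + (-((nsq a ^ 2)⁻¹) • ((2 : ℝ) • ipL a)).smulRight (conj a)) a := by
  have h1 : HasFDerivAt nsq ((2 : ℝ) • ipL a) a := by
    have := ipL.hasFDerivAt_of_bilinear (hasFDerivAt_id a) (hasFDerivAt_id a)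
    refine this.congr_fderiv ?_
    ext b
    simp only [_root_.add_apply, _root_.smul_apply, smul_eq_mul]
    change ip a b + ip b a = 2 * ip a b
    rw [ip_comm b a]; ring
  have h2 : HasFDerivAt (fun y => (nsq y)⁻¹) (-((nsq a ^ 2)⁻¹) • ((2 : ℝ) • ipL a)) a :=
    (hasDerivAt_inv h.ne').comp_hasFDerivAt a h1
  exact h2.smul conjL.hasFDerivAt

theorem hasFDerivAt_transition {x : Model} (hx : 0 < nsq x.1) :
    ∃ L : Model →L[ℝ] Model, HasFDerivAt transition L x ∧ ∀ X, L X = dtransition x X := by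
  have h1 : HasFDerivAt (fun y : Model => inv y.1) _ x :=
    HasFDerivAt.comp x (hasFDerivAt_inv hx) hasFDerivAt_fst
  have h2 := mulL.hasFDerivAt_of_bilinear (hasFDerivAt_snd (p := x) (𝕜 := ℝ)) h1
  refine ⟨_, h1.prodMk h2, fun X => ?_⟩
  have e : (nsq x.1)⁻¹ • conj X.1 + (-((nsq x.1 ^ 2)⁻¹) * (2 * ip x.1 X.1)) • conj x.1 =
      (nsq x.1)⁻¹ • conj X.1 - (2 * ip x.1 X.1 * (nsq x.1 ^ 2)⁻¹) • conj x.1 := by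
    rw [sub_eq_add_neg, ← neg_smul]; congr 2; ring
  rw [dtransition, ← e]
  refine Prod.ext rfl ?_
  exact add_comm _ _

/-- Every coordinate change is `(x, z) ↦ (x⁻¹, z x⁻¹)` up to the order of the two coordinates. -/
theorem affine_insertOne_cases {i j : Fin 3} (hij : i ≠ j) :
    ∃ σ τ : Model ≃L[ℝ] Model,
      (σ = .refl ℝ _ ∨ σ = .prodComm ℝ _ _) ∧ (τ = .refl ℝ _ ∨ τ = .prodComm ℝ _ _) ∧
      ∀ x, affine j (insertOne i x) = σ (transition (τ x)) ∧ insertOne i x j = (τ x).1 := by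
  let r : Model ≃L[ℝ] Model := .refl ℝ _
  let s : Model ≃L[ℝ] Model := .prodComm ℝ _ _
  have hr : ∀ x, r x = x := fun _ => rfl
  have hs : ∀ x, s x = x.swap := fun _ => rfl
  have key (σ τ : Model ≃L[ℝ] Model) (h1 : σ = r ∨ σ = s) (h2 : τ = r ∨ τ = s)
      (h : ∀ x, affine j (insertOne i x) = σ (transition (τ x)) ∧ insertOne i x j = (τ x).1) :=
    (⟨σ, τ, h1, h2, h⟩ : ∃ σ τ : Model ≃L[ℝ] Model, (σ = r ∨ σ = s) ∧ (τ = r ∨ τ = s) ∧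
      ∀ x, affine j (insertOne i x) = σ (transition (τ x)) ∧ insertOne i x j = (τ x).1)
  fin_cases i <;> fin_cases j <;> simp at hij
  · refine key r r (.inl rfl) (.inl rfl) fun x => ?_
    simp [hr, affine, insertOne, transition, Fin.succAbove, Fin.insertNth,
      Fin.succAboveCases, one_mul']
  · refine key r s (.inl rfl) (.inr rfl) fun x => ?_
    simp [hr, hs, affine, insertOne, transition, Fin.succAbove, Fin.insertNth,
      Fin.succAboveCases, one_mul']
  · refine key r r (.inl rfl) (.inl rfl) fun x => ?_
    simp [hr, affine, insertOne, transition, Fin.succAbove, Fin.insertNth,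
      Fin.succAboveCases, one_mul']
  · refine key s s (.inr rfl) (.inr rfl) fun x => ?_
    simp [hs, affine, insertOne, transition, Fin.succAbove, Fin.insertNth,
      Fin.succAboveCases, one_mul']
  · refine key s r (.inr rfl) (.inl rfl) fun x => ?_
    simp [hr, hs, affine, insertOne, transition, Fin.succAbove, Fin.insertNth,
      Fin.succAboveCases, one_mul']
  · refine key s s (.inr rfl) (.inr rfl) fun x => ?_
    simp [hs, affine, insertOne, transition, Fin.succAbove, Fin.insertNth,
      Fin.succAboveCases, one_mul']

theorem lineElement_affine {i j : Fin 3} {x : Model} (hx : x ∈ domain)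
    (hj : 0 < nsq (insertOne i x j)) (X : Model) :
    lineElement (affine j (insertOne i x)) (fderiv ℝ (fun y => affine j (insertOne i y)) x X)
      = lineElement x X := by
  rcases eq_or_ne i j with rfl | hij
  · have : (fun y => affine i (insertOne i y)) = id := funext fun y => affine_insertOne i y
    rw [this, affine_insertOne, fderiv_id]
    rfl
  obtain ⟨σ, τ, hσ, hτ, h⟩ := affine_insertOne_cases hij
  have inv_of (ρ : Model ≃L[ℝ] Model) (hρ : ρ = .refl ℝ _ ∨ ρ = .prodComm ℝ _ _) (y Y : Model) :
      lineElement (ρ y) (ρ Y) = lineElement y Y := by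
    rcases hρ with rfl | rfl
    · rfl
    · exact lineElement_swap y Y
  have hτd : τ x ∈ domain := by
    rcases hτ with rfl | rfl
    · exact hx
    · have hx' : 0 < 1 + nsq x.1 + nsq x.2 := hx
      change 0 < 1 + nsq x.2 + nsq x.1
      linarith
  have hpos : 0 < nsq (τ x).1 := by rw [← (h x).2]; exact hj
  obtain ⟨L, hL, hL'⟩ := hasFDerivAt_transition hpos
  have h1 : HasFDerivAt (fun y => affine j (insertOne i y))
      ((σ : Model →L[ℝ] Model).comp (L.comp (τ : Model →L[ℝ] Model))) x := by
    have : (fun y => affine j (insertOne i y)) = fun y => σ (transition (τ y)) :=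
      funext fun y => (h y).1
    rw [this]
    exact σ.hasFDerivAt.comp x (hL.comp x τ.hasFDerivAt)
  rw [h1.fderiv, (h x).1]
  change lineElement (σ _) (σ (L (τ X))) = _
  rw [inv_of σ hσ, hL', lineElement_transition hpos hτd, inv_of τ hτ]

/-- The metrics of the three charts agree on the overlaps. -/
theorem chartMetric_eq {i j : Fin 3} {P : ParaOctonionicPlane} (hi : P ∈ chartSource i)
    (hj : P ∈ chartSource j) : chartMetric i P = chartMetric j P := by
  set x := chart i P with hx
  have hPx : (chart i).symm x = P := (chart i).left_inv hi
  have hxd : x ∈ domain := (chart i).map_source hi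
  have hj' : 0 < nsq (insertOne i x j) := (chart_symm_mem hxd).1 (by rw [hPx]; exact hj)
  have hjx : chart j P = affine j (insertOne i x) := by rw [← chart_chart_symm hxd hj', hPx]
  have hdi : HasMFDerivAt 𝓘(ℝ, Model) 𝓘(ℝ, Model) (chart i) P _ :=
    (mdifferentiableAt_atlas (chart_mem_atlas i) hi).hasMFDerivAt
  have hdt : DifferentiableAt ℝ (fun y => affine j (insertOne i y)) x :=
    ((contDiffAt_affine j hj').comp x (contDiff_insertOne i).contDiffAt).differentiableAt
      (by simp)
  have hcomp := HasMFDerivAt.comp P (I' := 𝓘(ℝ, Model)) hdt.hasFDerivAt.hasMFDerivAt hdi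
  have hev : (chart j : ParaOctonionicPlane → Model) =ᶠ[𝓝 P]
      (fun y => affine j (insertOne i y)) ∘ chart i := by
    filter_upwards [(chart i).open_source.mem_nhds hi, (chart j).open_source.mem_nhds hj]
      with Q hQi hQj
    have hQ : (chart i).symm (chart i Q) = Q := (chart i).left_inv hQi
    have hd : chart i Q ∈ domain := (chart i).map_source hQi
    rw [Function.comp_apply, ← chart_chart_symm hd
      ((chart_symm_mem hd).1 (by rw [hQ]; exact hQj)), hQ]
  have hmf := (hcomp.congr_of_eventuallyEq hev).mfderiv
  let d : Model →L[ℝ] Model := mfderiv 𝓘(ℝ, Model) 𝓘(ℝ, Model) (chart i) P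
  let t : Model →L[ℝ] Model := fderiv ℝ (fun y => affine j (insertOne i y)) x
  have hd' : mfderiv 𝓘(ℝ, Model) 𝓘(ℝ, Model) (chart j) P = t.comp d := hmf
  have quad (X : Model) : coordForm (chart j P) (t X) (t X) = coordForm x X X := by
    rw [coordForm_self, coordForm_self, hjx]
    exact lineElement_affine hxd hj' X
  have bil (X Y : Model) : coordForm (chart j P) (t X) (t Y) = coordForm x X Y := by
    have h := quad (X + Y)
    simp only [map_add, _root_.add_apply, quad] at h
    rw [coordForm_symm _ (t Y), coordForm_symm _ Y X] at h
    linarith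
  have e1 : ∀ X Y : Model, chartMetric i P X Y = coordForm x (d X) (d Y) := fun _ _ => rfl
  have e2 : ∀ X Y : Model, chartMetric j P X Y = coordForm (chart j P) (t (d X)) (t (d Y)) := by
    intro X Y
    have e3 : chartMetric j P X Y =
      coordForm (chart j P) (mfderiv 𝓘(ℝ, Model) 𝓘(ℝ, Model) (chart j) P X)
        (mfderiv 𝓘(ℝ, Model) 𝓘(ℝ, Model) (chart j) P Y) := rfl
    rw [e3, hd']
    rfl
  refine ContinuousLinearMap.ext fun X => ContinuousLinearMap.ext fun Y => ?_
  exact (e1 X Y).trans ((bil (d X) (d Y)).symm.trans (e2 X Y).symm)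

/-- In each of the three charts the metric is given by `ds²`. -/
theorem metric_eq {i : Fin 3} {P : ParaOctonionicPlane} (hi : P ∈ chartSource i) :
    metric P = chartMetric i P := chartMetric_eq (mem_chartIndex P) hi

/-- The point `P₀ = [1, 0, 0]`. -/
def basePoint : ParaOctonionicPlane :=
  mk ⟨![1, 0, 0], mem_reduced.2 ⟨⟨0, rfl⟩, by simp [Fin.sum_univ_three, nsq_one, nsq_zero]⟩⟩

/-- The identification `(a, b) ↔ Σ aᵢ eᵢ + Σ bᵢ fᵢ` of pairs of para-octonions with tangent vectors at
`P₀`: the tangent vector with coordinates `(a, b)` in the chart `[1, u, v] ↦ (u, v)`. -/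
def tangentOfPair (a b : ParaOctonion) : TangentSpace 𝓘(ℝ, Model) basePoint :=
  (mfderiv 𝓘(ℝ, Model) 𝓘(ℝ, Model) (chart 0) basePoint).inverse (a, b)

end ParaOctonionicPlane

end

/-!
The chart at `P₀` sends `P₀` to the origin and there writes the metric as a quotient
`(⟨X, Y⟩ + Q x x) / (1 + ⟨x, x⟩) ^ 2` with `⟨·, ·⟩` a fixed nondegenerate form and `Q = Q_{X,Y}`
bilinear in the coordinates `x`. Numerator and denominator have no linear term, so the first
derivatives of the metric and with them the Christoffel symbols vanish at the origin, and the
curvature is the usual alternation of the second derivatives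
`Q p v + Q v p - 4 ⟨X, Y⟩ ⟨p, v⟩`. The resulting expression takes the stated form by the polarized
composition identity `⟨p q̄, r s̄⟩ + ⟨p s̄, r q̄⟩ = 2 ⟨p, r⟩ ⟨q, s⟩`.
-/

set_option maxSynthPendingDepth 3

section Calculus

variable {𝕜 E F G H : Type*} [NontriviallyNormedField 𝕜] [NormedAddCommGroup E] [NormedSpace 𝕜 E]
  [NormedAddCommGroup F] [NormedSpace 𝕜 F] [NormedAddCommGroup G] [NormedSpace 𝕜 G]
  [NormedAddCommGroup H] [NormedSpace 𝕜 H]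

theorem fderiv_fderiv_clm_comp_apply {f : E → F} {x : E} (L : F →L[𝕜] G)
    (hf : ContDiffAt 𝕜 2 f x) (p v : E) :
    fderiv 𝕜 (fderiv 𝕜 fun y => L (f y)) x p v = L (fderiv 𝕜 (fderiv 𝕜 f) x p v) := by
  have h := congrArg (· ![p, v]) (L.iteratedFDeriv_comp_left hf (i := 2) le_rfl)
  simpa [iteratedFDeriv_two_apply, Function.comp_def] using h

theorem fderiv_apply_apply_const {f : E → F →L[𝕜] G →L[𝕜] H} {x : E}
    (hf : DifferentiableAt 𝕜 f x) (X : F) (Y : G) (p : E) :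
    fderiv 𝕜 (fun y => f y X Y) x p = fderiv 𝕜 f x p X Y := by
  have h : HasFDerivAt (fun y => f y X Y) _ x :=
    (hf.hasFDerivAt.clm_apply (hasFDerivAt_const X x)).clm_apply (hasFDerivAt_const Y x)
  simp [h.fderiv]

theorem fderiv_fderiv_apply_apply_const {f : E → F →L[𝕜] G →L[𝕜] H} {x : E}
    (hf : ContDiffAt 𝕜 2 f x) (X : F) (Y : G) (p v : E) :
    fderiv 𝕜 (fderiv 𝕜 fun y => f y X Y) x p v = fderiv 𝕜 (fderiv 𝕜 f) x p v X Y :=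
  fderiv_fderiv_clm_comp_apply
    ((ContinuousLinearMap.apply 𝕜 H Y).comp (ContinuousLinearMap.apply 𝕜 (G →L[𝕜] H) X)) hf p v

theorem hasFDerivAt_bilin_diag (B : E →L[𝕜] E →L[𝕜] F) (x : E) :
    HasFDerivAt (fun y => B y y) (B x + B.flip x) x := by
  refine (B.hasFDerivAt_of_bilinear (hasFDerivAt_id x) (hasFDerivAt_id x)).congr_fderiv ?_
  ext v
  simp

theorem hasFDerivAt_comp_const_add_bilin_diag {φ : F → G} {w : F} {x : E}
    (B : E →L[𝕜] E →L[𝕜] F) (hφ : DifferentiableAt 𝕜 φ (w + B x x)) :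
    HasFDerivAt (fun y => φ (w + B y y)) ((fderiv 𝕜 φ (w + B x x)).comp (B x + B.flip x)) x :=
  hφ.hasFDerivAt.comp x ((hasFDerivAt_bilin_diag B x).const_add w)

theorem fderiv_comp_const_add_bilin_diag_zero {φ : F → G} {w : F} (hφ : DifferentiableAt 𝕜 φ w)
    (B : E →L[𝕜] E →L[𝕜] F) : fderiv 𝕜 (fun y => φ (w + B y y)) 0 = 0 := by
  simpa using (hasFDerivAt_comp_const_add_bilin_diag (x := 0) B (by simpa using hφ)).fderiv

theorem fderiv_fderiv_comp_const_add_bilin_diag_zero {φ : F → G} {w : F}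
    (hφ : ContDiffAt 𝕜 2 φ w) (B : E →L[𝕜] E →L[𝕜] F) (p v : E) :
    fderiv 𝕜 (fderiv 𝕜 fun y => φ (w + B y y)) 0 p v = fderiv 𝕜 φ w (B p v + B v p) := by
  have hw : Filter.Tendsto (fun y => w + B y y) (𝓝 0) (𝓝 w) := by
    have : Continuous fun y => w + B y y := by fun_prop
    simpa using this.tendsto 0
  have heq : fderiv 𝕜 (fun y => φ (w + B y y)) =ᶠ[𝓝 0]
      fun y => (fderiv 𝕜 φ (w + B y y)).comp ((B + B.flip) y) := by
    filter_upwards [hw.eventually (hφ.eventually (by simp))] with y hy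
    exact (hasFDerivAt_comp_const_add_bilin_diag B (hy.differentiableAt two_ne_zero)).fderiv
  have houter : DifferentiableAt 𝕜 (fun y => fderiv 𝕜 φ (w + B y y)) 0 := by
    refine DifferentiableAt.comp (0 : E) (g := fderiv 𝕜 φ) ?_
      ((hasFDerivAt_bilin_diag B 0).const_add w).differentiableAt
    simpa using (hφ.fderiv_right (m := 1) one_add_one_eq_two.le).differentiableAt one_ne_zero
  rw [heq.fderiv_eq, (houter.hasFDerivAt.clm_comp (B + B.flip).hasFDerivAt).fderiv]
  simp

end Calculus

section RealQuotient

theorem fderiv_div_sq_apply {c s : ℝ} (hs : s ≠ 0) (u : ℝ × ℝ) :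
    fderiv ℝ (fun y : ℝ × ℝ => y.1 / y.2 ^ 2) (c, s) u = u.1 / s ^ 2 - 2 * c * u.2 / s ^ 3 := by
  have hinv : HasDerivAt (fun t : ℝ => (t ^ 2)⁻¹) _ s :=
    (hasDerivAt_pow 2 s).fun_inv (pow_ne_zero 2 hs)
  have hden : HasFDerivAt (fun y : ℝ × ℝ => (y.2 ^ 2)⁻¹) _ (c, s) :=
    hinv.comp_hasFDerivAt (f := Prod.snd) (c, s) (hasFDerivAt_snd (𝕜 := ℝ) (p := (c, s)))
  have hquot : HasFDerivAt (fun y : ℝ × ℝ => y.1 / y.2 ^ 2) _ (c, s) :=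
    HasFDerivAt.mul hasFDerivAt_fst hden
  rw [hquot.fderiv]
  simp only [Nat.cast_ofNat, Nat.add_one_sub_one, pow_one, add_apply, smul_apply,
    ContinuousLinearMap.coe_snd', smul_eq_mul, ContinuousLinearMap.coe_fst']
  field_simp
  ring

variable {E : Type*} [NormedAddCommGroup E] [NormedSpace ℝ E]

theorem fderiv_div_sq_bilin_diag_zero (Q B : E →L[ℝ] E →L[ℝ] ℝ) (c : ℝ) :
    fderiv ℝ (fun x => (c + Q x x) / (1 + B x x) ^ 2) 0 = 0 :=
  fderiv_comp_const_add_bilin_diag_zero (φ := fun y : ℝ × ℝ => y.1 / y.2 ^ 2) (w := (c, 1))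
    (by fun_prop (disch := simp))
    ((ContinuousLinearMap.prodL (𝕜 := ℝ) (E := E) ℝ).toContinuousLinearMap.comp (Q.prod B))

theorem fderiv_fderiv_div_sq_bilin_diag_zero_apply (Q B : E →L[ℝ] E →L[ℝ] ℝ) (c : ℝ) (p v : E) :
    fderiv ℝ (fderiv ℝ fun x => (c + Q x x) / (1 + B x x) ^ 2) 0 p v =
      Q p v + Q v p - 2 * c * (B p v + B v p) := by
  let QB := (ContinuousLinearMap.prodL (𝕜 := ℝ) (E := E) ℝ).toContinuousLinearMap.comp (Q.prod B)
  refine (fderiv_fderiv_comp_const_add_bilin_diag_zero (φ := fun y : ℝ × ℝ => y.1 / y.2 ^ 2)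
    (w := (c, 1)) (by fun_prop (disch := simp)) QB p v).trans ?_
  rw [fderiv_div_sq_apply one_ne_zero]
  simp [QB]

end RealQuotient

theorem isInvertible_of_forall_apply_eq_zero {𝕜 E : Type*} [NontriviallyNormedField 𝕜]
    [CompleteSpace 𝕜] [NormedAddCommGroup E] [NormedSpace 𝕜 E] [FiniteDimensional 𝕜 E]
    {B : E →L[𝕜] E →L[𝕜] 𝕜} (hB : ∀ X, (∀ Y, B X Y = 0) → X = 0) : B.IsInvertible := by
  have hinj : Function.Injective (B : E →ₗ[𝕜] E →L[𝕜] 𝕜) :=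
    (injective_iff_map_eq_zero _).2 fun X hX => hB X fun Y => DFunLike.congr_fun hX Y
  have hrank : Module.finrank 𝕜 E = Module.finrank 𝕜 (E →L[𝕜] 𝕜) :=
    Subspace.dual_finrank_eq.symm.trans LinearMap.toContinuousLinearMap.finrank_eq
  exact ⟨((B : E →ₗ[𝕜] E →L[𝕜] 𝕜).linearEquivOfInjective hinj hrank).toContinuousLinearEquiv, rfl⟩

namespace SemiRiemannian

section Coordinates

variable {E : Type*} [NormedAddCommGroup E] [NormedSpace ℝ E] {G G' : E → E →L[ℝ] E →L[ℝ] ℝ}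
  {x : E}

theorem christoffel_eventuallyEq (h : G =ᶠ[𝓝 x] G') (v w : E) :
    (fun y => christoffel G y v w) =ᶠ[𝓝 x] fun y => christoffel G' y v w := by
  filter_upwards [h, h.fderiv (𝕜 := ℝ)] with y hy hy'
  simp only [christoffel, christoffelLower, hy, hy']

theorem coordCurvature_congr (h : G =ᶠ[𝓝 x] G') (X Y Z : E) :
    coordCurvature G x X Y Z = coordCurvature G' x X Y Z := by
  have hc (v w : E) : christoffel G x v w = christoffel G' x v w :=
    (christoffel_eventuallyEq h v w).self_of_nhds
  simp only [coordCurvature, (christoffel_eventuallyEq h _ _).fderiv_eq, hc]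

theorem christoffelLower_apply (G : E → E →L[ℝ] E →L[ℝ] ℝ) (x v w z : E) :
    christoffelLower G x v w z =
      (1 / 2) * (fderiv ℝ G x v w z + fderiv ℝ G x w v z - fderiv ℝ G x z v w) := by
  simp [christoffelLower]

theorem christoffelLower_eq_zero (h : fderiv ℝ G x = 0) (v w : E) :
    christoffelLower G x v w = 0 := by
  ext z
  simp [christoffelLower_apply, h]

theorem christoffel_eq_zero (h : fderiv ℝ G x = 0) (v w : E) : christoffel G x v w = 0 := by
  rw [christoffel, christoffelLower_eq_zero h, map_zero]

theorem differentiableAt_christoffelLower (h : DifferentiableAt ℝ (fderiv ℝ G) x) (v w : E) :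
    DifferentiableAt ℝ (fun y => christoffelLower G y v w) x := by
  let flipL := ContinuousLinearMap.flipₗᵢ ℝ E E (E →L[ℝ] ℝ)
  let flipL' := ContinuousLinearMap.flipₗᵢ ℝ E E ℝ
  have hflip : DifferentiableAt ℝ (fun y => flipL' (flipL (fderiv ℝ G y) v) w) x := by fun_prop
  have (a b : E) : DifferentiableAt ℝ (fun y => fderiv ℝ G y a b) x := by fun_prop
  exact (((this v w).add (this w v)).sub hflip).const_smul (1 / 2 : ℝ)

theorem fderiv_christoffelLower_apply (h : DifferentiableAt ℝ (fderiv ℝ G) x) (v w p z : E) :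
    fderiv ℝ (fun y => christoffelLower G y v w) x p z =
      (1 / 2) * (fderiv ℝ (fderiv ℝ G) x p v w z + fderiv ℝ (fderiv ℝ G) x p w v z
        - fderiv ℝ (fderiv ℝ G) x p z v w) := by
  have hlower : HasFDerivAt (fun y => christoffelLower G y v w z) _ x :=
    (differentiableAt_christoffelLower h v w).hasFDerivAt.clm_apply (hasFDerivAt_const z x)
  have happly (a b c : E) : HasFDerivAt (fun y => fderiv ℝ G y a b c) _ x :=
    ((h.hasFDerivAt.clm_apply (hasFDerivAt_const a x)).clm_apply
      (hasFDerivAt_const b x)).clm_apply (hasFDerivAt_const c x)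
  have hsum := (((happly v w z).add (happly w v z)).sub (happly z v w)).const_mul (1 / 2)
  simp only [christoffelLower_apply] at hlower
  simpa using DFunLike.congr_fun (hlower.unique hsum) p

theorem fderiv_christoffel_of_fderiv_eq_zero [CompleteSpace E] (hG : ContDiffAt ℝ 2 G x)
    (hd : fderiv ℝ G x = 0) (hi : (G x).IsInvertible) (v w p : E) :
    fderiv ℝ (fun y => christoffel G y v w) x p =
      (G x).inverse (fderiv ℝ (fun y => christoffelLower G y v w) x p) := by
  have hinv : DifferentiableAt ℝ (fun y => (G y).inverse) x :=
    ((hi.contDiffAt_map_inverse (n := 1)).differentiableAt one_ne_zero).comp x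
      (hG.differentiableAt two_ne_zero)
  have hlower : DifferentiableAt ℝ (fun y => christoffelLower G y v w) x :=
    differentiableAt_christoffelLower
      ((hG.fderiv_right (m := 1) one_add_one_eq_two.le).differentiableAt one_ne_zero) v w
  have h : HasFDerivAt (fun y => christoffel G y v w) _ x :=
    hinv.hasFDerivAt.clm_apply hlower.hasFDerivAt
  simp [h.fderiv, christoffelLower_eq_zero hd]

theorem apply_coordCurvature_of_fderiv_eq_zero [CompleteSpace E] (hG : ContDiffAt ℝ 2 G x)
    (hd : fderiv ℝ G x = 0) (hi : (G x).IsInvertible) (X Y Z W : E) :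
    G x (coordCurvature G x X Y Z) W =
      (1 / 2) * (fderiv ℝ (fderiv ℝ G) x Y Z X W - fderiv ℝ (fderiv ℝ G) x Y W X Z
        - fderiv ℝ (fderiv ℝ G) x X Z Y W + fderiv ℝ (fderiv ℝ G) x X W Y Z) := by
  have hD : DifferentiableAt ℝ (fderiv ℝ G) x :=
    (hG.fderiv_right (m := 1) one_add_one_eq_two.le).differentiableAt one_ne_zero
  have hsymm : IsSymmSndFDerivAt ℝ G x := hG.isSymmSndFDerivAt (by simp)
  simp only [coordCurvature, christoffel_eq_zero hd, add_zero, sub_zero,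
    fderiv_christoffel_of_fderiv_eq_zero hG hd hi, map_sub, hi.self_apply_inverse,
    sub_apply, fderiv_christoffelLower_apply hD, hsymm.eq Y X]
  ring

end Coordinates

section Manifold

variable {E : Type*} [NormedAddCommGroup E] [NormedSpace ℝ E]
  {M : Type*} [TopologicalSpace M] [ChartedSpace E M]
  {g : ∀ p : M, TangentSpace 𝓘(ℝ, E) p →L[ℝ] TangentSpace 𝓘(ℝ, E) p →L[ℝ] ℝ}

theorem riemannTensor_eq_of_inChart_eventuallyEq {p : M} {e : OpenPartialHomeomorph M E}
    {G : E → E →L[ℝ] E →L[ℝ] ℝ} (he : chartAt E p = e) (hG : inChart g e =ᶠ[𝓝 (e p)] G)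
    (X Y Z W : TangentSpace 𝓘(ℝ, E) p) :
    riemannTensor g p X Y Z W =
      G (e p) (coordCurvature G (e p) (mfderiv 𝓘(ℝ, E) 𝓘(ℝ, E) e p X)
        (mfderiv 𝓘(ℝ, E) 𝓘(ℝ, E) e p Y) (mfderiv 𝓘(ℝ, E) 𝓘(ℝ, E) e p Z))
        (mfderiv 𝓘(ℝ, E) 𝓘(ℝ, E) e p W) := by
  subst he
  rw [riemannTensor, coordCurvature_congr hG, hG.self_of_nhds]
  rfl

end Manifold

end SemiRiemannian

namespace ParaOctonion

theorem zero_mul' (a : ParaOctonion) : 0 * a = 0 := by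
  simpa using ParaOctonion.smul_mul' 0 0 a

theorem ip_sub_left (a b c : ParaOctonion) : ip (a - b) c = ip a c - ip b c :=
  DFunLike.congr_fun (map_sub ParaOctonionicPlane.ipL a b) c

theorem ip_sub_right (a b c : ParaOctonion) : ip a (b - c) = ip a b - ip a c :=
  map_sub (ParaOctonionicPlane.ipL a) b c

theorem re_mul_conj_mul_mul_conj (p q r s : ParaOctonion) :
    re ((p * conj q) * (r * conj s)) = ip (p * conj q) (s * conj r) := by
  rw [ParaOctonionicPlane.re_mul_eq_ip, ← ip_conj_conj, conj_mul, conj_mul, conj_conj, conj_conj]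

theorem ip_mul_conj_add_ip_mul_conj (p q r s : ParaOctonion) :
    ip (p * conj q) (r * conj s) + ip (p * conj s) (r * conj q) = 2 * ip p r * ip q s := by
  rw [ip_exchange, ip_conj_conj]

theorem eq_zero_of_forall_ip_eq_zero {a : ParaOctonion} (h : ∀ b, ip a b = 0) : a = 0 := by
  have hsum : Quaternion.normSq a.1 + Quaternion.normSq a.2 = 0 := by
    obtain ⟨b, hb₁, hb₂⟩ : ∃ b : ParaOctonion, b.1 = a.1 ∧ b.2 = -a.2 := ⟨(a.1, -a.2), rfl, rfl⟩
    refine Eq.trans ?_ (h b)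
    rw [Quaternion.normSq_def', Quaternion.normSq_def', ip_eq, hb₁, hb₂, Quaternion.re_neg,
      Quaternion.imI_neg, Quaternion.imJ_neg, Quaternion.imK_neg]
    ring
  have h₁ := Quaternion.normSq_nonneg (a := a.1)
  have h₂ := Quaternion.normSq_nonneg (a := a.2)
  exact Prod.ext (Quaternion.normSq_eq_zero.1 (by linarith))
    (Quaternion.normSq_eq_zero.1 (by linarith))

end ParaOctonion

namespace ParaOctonionicPlane

open ParaOctonion

/-- The scalar product `⟨X.1, Y.1⟩ + ⟨X.2, Y.2⟩` on `Model`. -/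
noncomputable def modelForm : Model →L[ℝ] Model →L[ℝ] ℝ :=
  ipL.bilinearComp (.fst ℝ ParaOctonion ParaOctonion) (.fst ℝ ParaOctonion ParaOctonion) +
    ipL.bilinearComp (.snd ℝ ParaOctonion ParaOctonion) (.snd ℝ ParaOctonion ParaOctonion)

theorem modelForm_apply (X Y : Model) : modelForm X Y = ip X.1 Y.1 + ip X.2 Y.2 := rfl

/-- The bilinear form in `(p, v)` whose diagonal is the part of the numerator of `ds²(X, Y)` that is
quadratic in the coordinates `p`. The form is not symmetric; only its diagonal matters. -/
noncomputable def numeratorForm (X Y : Model) : Model →L[ℝ] Model →L[ℝ] ℝ :=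
  (LinearMap.mk₂ ℝ (fun p v : Model => ip X.1 Y.1 * ip p.2 v.2 + ip X.2 Y.2 * ip p.1 v.1
      - ip (p.1 * conj v.2) (Y.1 * conj X.2 + X.1 * conj Y.2))
    (fun _ _ _ => by simp only [Prod.fst_add, Prod.snd_add, ip_add_left, add_mul']; ring)
    (fun _ _ _ => by
      simp only [Prod.smul_fst, Prod.smul_snd, ip_smul_left, ParaOctonion.smul_mul', smul_eq_mul]
      ring)
    (fun _ _ _ => by
      simp only [Prod.fst_add, Prod.snd_add, ip_add_left, ip_add_right, conj_add, mul_add']; ring)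
    (fun _ _ _ => by
      simp only [Prod.smul_fst, Prod.smul_snd, ip_smul_left, ip_smul_right, conj_smul, mul_smul',
        smul_eq_mul]
      ring)).toContinuousBilinearMap

theorem numeratorForm_apply (X Y p v : Model) :
    numeratorForm X Y p v = ip X.1 Y.1 * ip p.2 v.2 + ip X.2 Y.2 * ip p.1 v.1
      - ip (p.1 * conj v.2) (Y.1 * conj X.2 + X.1 * conj Y.2) := rfl

theorem coordForm_apply_eq_div (x X Y : Model) :
    coordForm x X Y = (modelForm X Y + numeratorForm X Y x x) / (1 + modelForm x x) ^ 2 := by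
  simp only [coordForm_apply, modelForm_apply, numeratorForm_apply, ip_add_right,
    re_mul_conj_mul_mul_conj, nsq]
  ring

theorem coordForm_zero : coordForm 0 = modelForm := by
  refine ContinuousLinearMap.ext fun X => ContinuousLinearMap.ext fun Y => ?_
  simp [coordForm_apply_eq_div]

theorem contDiffOn_coordForm : ContDiffOn ℝ ∞ coordForm domain := by
  refine contDiffOn_clm_apply.2 fun X => contDiffOn_clm_apply.2 fun Y => ?_
  simp only [coordForm_apply_eq_div]
  refine ContDiffOn.div (by fun_prop) (by fun_prop) fun x hx => pow_ne_zero 2 ?_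
  rw [modelForm_apply, ← add_assoc]
  exact ne_of_gt hx

theorem contDiffAt_coordForm_zero : ContDiffAt ℝ 2 coordForm 0 :=
  (contDiffOn_coordForm.contDiffAt (isOpen_domain.mem_nhds zero_mem_domain)).of_le (by norm_cast)

theorem fderiv_coordForm_zero : fderiv ℝ coordForm 0 = 0 := by
  refine ContinuousLinearMap.ext fun v => ContinuousLinearMap.ext fun X =>
    ContinuousLinearMap.ext fun Y => ?_
  rw [← fderiv_apply_apply_const (contDiffAt_coordForm_zero.differentiableAt two_ne_zero)]
  simp only [coordForm_apply_eq_div, fderiv_div_sq_bilin_diag_zero, zero_apply]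

theorem fderiv_fderiv_coordForm_zero_apply (p v X Y : Model) :
    fderiv ℝ (fderiv ℝ coordForm) 0 p v X Y =
      numeratorForm X Y p v + numeratorForm X Y v p
        - 2 * modelForm X Y * (modelForm p v + modelForm v p) := by
  rw [← fderiv_fderiv_apply_apply_const contDiffAt_coordForm_zero]
  simp only [coordForm_apply_eq_div, fderiv_fderiv_div_sq_bilin_diag_zero_apply]

theorem isInvertible_coordForm_zero : (coordForm 0).IsInvertible := by
  refine isInvertible_of_forall_apply_eq_zero fun X hX => ?_
  simp only [coordForm_zero, modelForm_apply] at hX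
  have hzero (a : ParaOctonion) : ip a 0 = 0 := map_zero (ipL a)
  exact Prod.ext (eq_zero_of_forall_ip_eq_zero fun b => by simpa [hzero] using hX (b, 0))
    (eq_zero_of_forall_ip_eq_zero fun b => by simpa [hzero] using hX (0, b))

theorem coordForm_coordCurvature_zero (a b c d e f g h : ParaOctonion) :
    coordForm 0 (SemiRiemannian.coordCurvature coordForm 0 (a, b) (c, d) (e, f)) (g, h) =
      4 * (ip a e * ip c g) - 4 * (ip c e * ip a g)
        + 4 * (ip b f * ip d h) - 4 * (ip d f * ip b h)
        - ip (e * conj d) (g * conj b) + ip (e * conj b) (g * conj d)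
        - ip (c * conj f) (a * conj h) + ip (a * conj f) (c * conj h)
        - ip (a * conj d - c * conj b) (g * conj f - e * conj h) := by
  rw [SemiRiemannian.apply_coordCurvature_of_fderiv_eq_zero contDiffAt_coordForm_zero
    fderiv_coordForm_zero isInvertible_coordForm_zero]
  simp only [fderiv_fderiv_coordForm_zero_apply, numeratorForm_apply, modelForm_apply,
    ip_add_right, ip_sub_left, ip_sub_right]
  have hacfh := ip_mul_conj_add_ip_mul_conj a f c h
  have haedh := ip_mul_conj_add_ip_mul_conj a d e h
  have hagdf := ip_mul_conj_add_ip_mul_conj a d g f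
  have hcebh := ip_mul_conj_add_ip_mul_conj c b e h
  have hcgbf := ip_mul_conj_add_ip_mul_conj c b g f
  have hegbd := ip_mul_conj_add_ip_mul_conj e b g d
  simp only [ip_comm] at hacfh haedh hagdf hcebh hcgbf hegbd ⊢
  linarith

theorem basePoint_mem_chartSource : basePoint ∈ chartSource 0 :=
  mk_mem_chartSource.2 (by simp [nsq_one])

theorem chartIndex_basePoint : chartIndex basePoint = 0 := by
  classical
  exact (Fin.find_eq_iff _).2 ⟨basePoint_mem_chartSource, fun j hj => absurd hj (Fin.not_lt_zero j)⟩

theorem chartAt_basePoint : chartAt Model basePoint = chart 0 :=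
  congrArg chart chartIndex_basePoint

theorem chart_basePoint : chart 0 basePoint = 0 := by
  rw [chart_apply, basePoint, chartFun_mk (by simp [nsq_one])]
  simp [affine, ParaOctonion.zero_mul', Fin.succAbove]

theorem mdifferentiable_chart (i : Fin 3) :
    (chart i).MDifferentiable 𝓘(ℝ, Model) 𝓘(ℝ, Model) :=
  mdifferentiable_of_mem_atlas (chart_mem_atlas i)

theorem inChart_metric (i : Fin 3) {x : Model} (hx : x ∈ domain) :
    SemiRiemannian.inChart metric (chart i) x = coordForm x := by
  have hmem : (chart i).symm x ∈ chartSource i := (chart i).map_target hx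
  have hderiv (X : Model) : mfderiv 𝓘(ℝ, Model) 𝓘(ℝ, Model) (chart i) ((chart i).symm x)
      (mfderiv 𝓘(ℝ, Model) 𝓘(ℝ, Model) (chart i).symm x X) = X :=
    DFunLike.congr_fun ((mdifferentiable_chart i).comp_symm_deriv hx) X
  refine ContinuousLinearMap.ext fun X => ContinuousLinearMap.ext fun Y => ?_
  rw [SemiRiemannian.inChart, metric_eq hmem]
  change coordForm (chart i ((chart i).symm x))
    (mfderiv 𝓘(ℝ, Model) 𝓘(ℝ, Model) (chart i) ((chart i).symm x)
      (mfderiv 𝓘(ℝ, Model) 𝓘(ℝ, Model) (chart i).symm x X))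
    (mfderiv 𝓘(ℝ, Model) 𝓘(ℝ, Model) (chart i) ((chart i).symm x)
      (mfderiv 𝓘(ℝ, Model) 𝓘(ℝ, Model) (chart i).symm x Y)) = _
  rw [hderiv, hderiv, (chart i).right_inv hx]

theorem mfderiv_chart_tangentOfPair (a b : ParaOctonion) :
    mfderiv 𝓘(ℝ, Model) 𝓘(ℝ, Model) (chart 0) basePoint (tangentOfPair a b) = (a, b) := by
  have h : (mfderiv 𝓘(ℝ, Model) 𝓘(ℝ, Model) (chart 0) basePoint).IsInvertible :=
    ⟨(mdifferentiable_chart 0).mfderiv basePoint_mem_chartSource, rfl⟩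
  exact h.self_apply_inverse _

theorem riemannTensor_metric_basePoint (a b c d e f g h : ParaOctonion) :
    SemiRiemannian.riemannTensor metric basePoint
        (tangentOfPair a b) (tangentOfPair c d) (tangentOfPair e f) (tangentOfPair g h) =
      coordForm 0 (SemiRiemannian.coordCurvature coordForm 0 (a, b) (c, d) (e, f)) (g, h) := by
  have hmetric : SemiRiemannian.inChart metric (chart 0) =ᶠ[𝓝 (chart 0 basePoint)] coordForm := by
    rw [chart_basePoint]
    filter_upwards [isOpen_domain.mem_nhds zero_mem_domain] with x hx using inChart_metric 0 hx
  rw [SemiRiemannian.riemannTensor_eq_of_inChart_eventuallyEq chartAt_basePoint hmetric]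
  simp only [mfderiv_chart_tangentOfPair, chart_basePoint]

end ParaOctonionicPlane

theorem corollaryR (a b c d e f g h : ParaOctonion) :
    SemiRiemannian.riemannTensor ParaOctonionicPlane.metric ParaOctonionicPlane.basePoint
        (ParaOctonionicPlane.tangentOfPair a b) (ParaOctonionicPlane.tangentOfPair c d)
        (ParaOctonionicPlane.tangentOfPair e f) (ParaOctonionicPlane.tangentOfPair g h) =
      4 * (ParaOctonion.ip a e * ParaOctonion.ip c g)
        - 4 * (ParaOctonion.ip c e * ParaOctonion.ip a g)
        + 4 * (ParaOctonion.ip b f * ParaOctonion.ip d h)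
        - 4 * (ParaOctonion.ip d f * ParaOctonion.ip b h)
        - ParaOctonion.ip (e * d.conj) (g * b.conj) + ParaOctonion.ip (e * b.conj) (g * d.conj)
        - ParaOctonion.ip (c * f.conj) (a * h.conj) + ParaOctonion.ip (a * f.conj) (c * h.conj)
        - ParaOctonion.ip (a * d.conj - c * b.conj) (g * f.conj - e * h.conj) := by
  rw [ParaOctonionicPlane.riemannTensor_metric_basePoint,
    ParaOctonionicPlane.coordForm_coordCurvature_zero]
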